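/- Let $N$ be an odd prime, let $R=\mathbb{R}[x]/\langle x^N-1\rangle$ and $O=\mathbb{Z}[x]/\langle \Phi_N\rangle\cong\mathbb{Z}[\zeta]$, where $\Phi_N=x^{N-1}+\cdots+x+1$ is the $N$th cyclotomic polynomial and $\zeta$ is the class of $x$ in $O$. Write $[\alpha]_i$ for the components of $\alpha\in R$ in the basis $1,x,\dots,x^{N-1}$ and $[\beta]_j$ for those of $\beta\in O$ in the basis $\zeta,\dots,\zeta^{N-1}$. Let $\alpha\mapsto\overline{\alpha}$ be the conjugation of $R$, the $\mathbb{R}$-algebra automorphism with $x\mapsto x^{-1}$. Equip $R$ with the Euclidean structure for which $1,x,\dots,x^{N-1}$ is orthonormal. Let $\beta\in O$ and $r\in\mathbb{R}$, and let $\beta_R\in R$ be the embedding of $\beta$ with shift $r$, that is, $[\beta_R]_0=r$ and $[\beta_R]_j=[\beta]_j+r$ for $1\le j\le N-1$. Assume that $\sum_{i=0}^{N-1}[\beta_R]_i\ne 0$, i.e. $r\neq-\frac1N\sum_{j=1}^{N-1}[\beta]_j$. Put $\alpha=\beta_R\overline{\beta}_R$ and $$T_\alpha=\{\tau\in R:\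 \tau\overline{\tau}=\alpha\}.$$ If $\beta\ne 0$, then $T_\alpha$ is a pair of smooth tori of dimension $\frac{N-1}{2}$, i.e. the union of two disjoint smoothly embedded copies of $(\mathbb{R}/\mathbb{Z})^{(N-1)/2}$ in $R$. For every such $\beta$ (including $\beta=0$) the $\frac{N-1}{2}$-dimensional volume of $T_\alpha$ is $$\mathrm{vol}(T_\alpha)=2\left(\frac{8\pi^2}{N}\right)^{\frac{N-1}{4}}\sqrt{\mathcal{N}(\beta)},$$ where $\mathcal{N}(\beta)\in\mathbb{Z}$ is the algebraic norm of $\beta$ (the product of its conjugates). -/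

import Mathlib

open scoped MeasureTheory ContDiff
open Polynomial

namespace BitRetrieval

/-! ### The ring of real cyclic sequences -/

/-- The ring `R = ℝ[x] / ⟨x ^ N - 1⟩` of real cyclic sequences of length `N`. -/
abbrev CycR (N : ℕ) : Type := AdjoinRoot (X ^ N - 1 : ℝ[X])

/-- The class of `x` in `R`. -/
noncomputable abbrev CycR.x (N : ℕ) : CycR N := AdjoinRoot.root (X ^ N - 1 : ℝ[X])

theorem monic_X_pow_sub_one (N : ℕ) [Fact N.Prime] : (X ^ N - 1 : ℝ[X]).Monic := by
  simpa using monic_X_pow_sub_C (1 : ℝ) (Fact.out : N.Prime).ne_zero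

theorem CycR.x_pow (N : ℕ) : CycR.x N ^ N = 1 := by
  have h := AdjoinRoot.eval₂_root (X ^ N - 1 : ℝ[X])
  simp only [eval₂_sub, eval₂_pow, eval₂_X, eval₂_one] at h
  exact sub_eq_zero.1 h

/-- The standard basis `1, x, …, x ^ (N - 1)` of `R`. -/
noncomputable def CycR.basis (N : ℕ) [Fact N.Prime] : Module.Basis (Fin N) ℝ (CycR N) :=
  (AdjoinRoot.powerBasis' (monic_X_pow_sub_one N)).basis.reindex
    (finCongr (by
      rw [AdjoinRoot.powerBasis'_dim]
      simpa using natDegree_X_pow_sub_C (R := ℝ) (n := N) (r := 1)))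

theorem CycR.basis_apply (N : ℕ) [Fact N.Prime] (i : Fin N) :
    CycR.basis N i = CycR.x N ^ (i : ℕ) := by
  simp [CycR.basis]

/-- The `i`th component `[α]_i` of `α` in the standard basis of `R`. -/
noncomputable def CycR.comp {N : ℕ} [Fact N.Prime] (α : CycR N) (i : Fin N) : ℝ :=
  (CycR.basis N).repr α i

/-- The zero-frequency Fourier component `σ₀(α) = ∑ i, [α]_i`. -/
noncomputable def CycR.sigmaZero {N : ℕ} [Fact N.Prime] (α : CycR N) : ℝ :=
  ∑ i : Fin N, CycR.comp α i

/-- The conjugation `α ↦ ᾱ` of `R`: the ring automorphism with `x ↦ x⁻¹ = x ^ (N - 1)`. -/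
noncomputable def CycR.bar (N : ℕ) : CycR N →ₐ[ℝ] CycR N :=
  AdjoinRoot.liftAlgHom (X ^ N - 1 : ℝ[X]) (Algebra.ofId ℝ (CycR N)) (CycR.x N ^ (N - 1)) (by
    simp only [eval₂_sub, eval₂_pow, eval₂_X, eval₂_one]
    rw [← pow_mul, mul_comm, pow_mul, CycR.x_pow, one_pow, sub_self])

/-- In components, `[ᾱ]_i = [α]_{-i}` with indices modulo `N`. -/
theorem CycR.comp_bar {N : ℕ} [Fact N.Prime] [NeZero N] (α : CycR N) (i : Fin N) :
    CycR.comp (CycR.bar N α) i = CycR.comp α (-i) := by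
  have key : ∀ j : Fin N, CycR.bar N (CycR.basis N j) = CycR.basis N (-j) := by
    intro j
    rw [CycR.basis_apply, CycR.basis_apply, map_pow, CycR.bar]
    rw [AdjoinRoot.liftAlgHom_root, ← pow_mul]
    rw [Fin.val_neg']
    rw [← pow_mod_orderOf, ← pow_mod_orderOf (CycR.x N) ((N - (j : ℕ)) % N)]
    congr 1
    have hd : orderOf (CycR.x N) ∣ N := orderOf_dvd_of_pow_eq_one (CycR.x_pow N)
    refine Nat.ModEq.of_dvd hd ?_
    refine Nat.ModEq.trans ?_ (Nat.mod_modEq _ _).symm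
    have hj : (j : ℕ) ≤ N := j.2.le
    have hN : 1 ≤ N := (Fact.out : N.Prime).one_lt.le
    rw [← ZMod.natCast_eq_natCast_iff]
    push_cast [hj, hN]
    simp
  have hlin : (CycR.bar N).toLinearMap =
      (CycR.basis N).constr ℝ (fun j => CycR.basis N (-j)) := by
    refine (CycR.basis N).ext fun j => ?_
    rw [Module.Basis.constr_basis]
    exact key j
  have h : CycR.bar N α = ∑ j, CycR.comp α j • CycR.basis N (-j) := by
    have := congrArg (fun f => f α) hlin
    simpa [Module.Basis.constr_apply_fintype, CycR.comp] using this
  rw [CycR.comp, h]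
  simp only [map_sum, map_smul, Module.Basis.repr_self, Finsupp.coe_finsetSum, Finset.sum_apply,
    Finsupp.smul_apply, Finsupp.single_apply, smul_eq_mul, mul_ite, mul_one, mul_zero]
  rw [Finset.sum_eq_single (-i)]
  · simp
  · intro b _ hb
    rw [if_neg]
    rintro rfl
    simp at hb
  · simp

/-- The set `T_α = {τ ∈ R : τ τ̄ = α}`. -/
def torusSet {N : ℕ} (α : CycR N) : Set (CycR N) := {τ | τ * CycR.bar N τ = α}

/-! ### The Euclidean structure of `R` -/

/-- `R` identified with Euclidean `N`-space through its components in the standard basis. -/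
noncomputable def CycR.toEuclidean (N : ℕ) [Fact N.Prime] :
    CycR N ≃ₗ[ℝ] EuclideanSpace ℝ (Fin N) :=
  (CycR.basis N).equivFun.trans (WithLp.linearEquiv 2 ℝ (Fin N → ℝ)).symm

theorem CycR.toEuclidean_apply {N : ℕ} [Fact N.Prime] (α : CycR N) (i : Fin N) :
    CycR.toEuclidean N α i = CycR.comp α i := rfl

/-- The `d`-dimensional volume of a subset of `R`, with respect to the Euclidean structure in which
the standard basis is orthonormal: the `d`-dimensional Hausdorff measure, normalized so that it is
Lebesgue measure on Euclidean `d`-space. -/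
noncomputable def CycR.vol {N : ℕ} [Fact N.Prime] (d : ℕ) (S : Set (CycR N)) : ENNReal :=
  μHE[d] (CycR.toEuclidean N '' S)

/-- `S` is a smoothly embedded `d`-dimensional torus: the image of a smooth immersion of `ℝᵈ`
that factors through an injective map on `ℝᵈ / ℤᵈ`. (By compactness of `ℝᵈ / ℤᵈ` the induced map is
an embedding.) -/
def IsSmoothTorus {E : Type*} [NormedAddCommGroup E] [NormedSpace ℝ E] (d : ℕ) (S : Set E) :
    Prop :=
  ∃ g : EuclideanSpace ℝ (Fin d) → E, ContDiff ℝ ∞ g ∧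
    (∀ u, Function.Injective (fderiv ℝ g u)) ∧
    (∀ u v, g u = g v ↔ ∀ i, ∃ k : ℤ, u i - v i = k) ∧
    Set.range g = S

/-- `S` is a pair of smooth `d`-dimensional tori: the union of two disjoint smoothly embedded
`d`-dimensional tori. -/
def IsPairOfSmoothTori {E : Type*} [NormedAddCommGroup E] [NormedSpace ℝ E] (d : ℕ) (S : Set E) :
    Prop :=
  ∃ A B : Set E, IsSmoothTorus d A ∧ IsSmoothTorus d B ∧ Disjoint A B ∧ A ∪ B = S

/-! ### The ring of cyclotomic integers -/

/-- The ring `O = ℤ[x] / ⟨Φ_N⟩` of cyclotomic integers. -/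
abbrev CycO (N : ℕ) : Type := AdjoinRoot (cyclotomic N ℤ)

/-- The class `ζ` of `x` in `O`. -/
noncomputable abbrev CycO.zeta (N : ℕ) : CycO N := AdjoinRoot.root (cyclotomic N ℤ)

theorem CycO.zeta_pow (N : ℕ) : CycO.zeta N ^ N = 1 := by
  obtain ⟨q, hq⟩ := cyclotomic.dvd_X_pow_sub_one N ℤ
  have h : AdjoinRoot.mk (cyclotomic N ℤ) (X ^ N - 1) = 0 := by
    rw [hq, map_mul, AdjoinRoot.mk_self, zero_mul]
  rw [map_sub, map_pow, AdjoinRoot.mk_X, map_one] at h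
  exact sub_eq_zero.1 h

theorem CycO.isUnit_zeta (N : ℕ) [Fact N.Prime] : IsUnit (CycO.zeta N) :=
  IsUnit.of_pow_eq_one (CycO.zeta_pow N) (Fact.out : N.Prime).ne_zero

/-- The standard basis `ζ, ζ ^ 2, …, ζ ^ (N - 1)` of `O`; the element with index `j` is
`ζ ^ (j + 1)`. -/
noncomputable def CycO.basis (N : ℕ) [Fact N.Prime] : Module.Basis (Fin (N - 1)) ℤ (CycO N) :=
  ((AdjoinRoot.powerBasis' (cyclotomic.monic N ℤ)).basis.reindex
    (finCongr (by
      rw [AdjoinRoot.powerBasis'_dim, natDegree_cyclotomic,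
        Nat.totient_prime (Fact.out : N.Prime)]))).map
    (LinearEquiv.smulOfUnit (R := CycO N) (M := CycO N) (CycO.isUnit_zeta N).unit
      |>.restrictScalars ℤ)

theorem CycO.basis_apply (N : ℕ) [Fact N.Prime] (j : Fin (N - 1)) :
    CycO.basis N j = CycO.zeta N ^ ((j : ℕ) + 1) := by
  simp [CycO.basis, LinearEquiv.smulOfUnit, pow_succ', Units.smul_def]

/-- The component `[β]_{j+1}` of `β` in the standard basis of `O`, i.e. the coefficient of
`ζ ^ (j + 1)`, for `0 ≤ j < N - 1`. -/
noncomputable def CycO.comp {N : ℕ} [Fact N.Prime] (β : CycO N) (j : Fin (N - 1)) : ℤ :=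
  (CycO.basis N).repr β j

/-- The embedding `β_R` of `β ∈ O` in `R` with shift `r`: `[β_R]_0 = r` and
`[β_R]_j = [β]_j + r` for `1 ≤ j ≤ N - 1`. -/
noncomputable def embed {N : ℕ} [Fact N.Prime] (r : ℝ) (β : CycO N) : CycR N :=
  r • 1 + ∑ j : Fin (N - 1), ((CycO.comp β j : ℝ) + r) • CycR.x N ^ ((j : ℕ) + 1)

/-- The algebraic norm `𝒩(β)` of `β ∈ O`. -/
noncomputable def CycO.norm {N : ℕ} (β : CycO N) : ℤ := Algebra.norm ℤ β

/-- The conjugate map `σ_j : O → ℂ`, `ζ ↦ exp (2 π i j / N)`, for `1 ≤ j ≤ N - 1`. It is written here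
with index `j + 1`. -/
noncomputable def CycO.sigma (N : ℕ) [Fact N.Prime] (j : Fin (N - 1)) : CycO N →+* ℂ :=
  AdjoinRoot.lift (Int.castRingHom ℂ)
    (Complex.exp (2 * Real.pi * Complex.I / N) ^ ((j : ℕ) + 1)) (by
      have hp : N.Prime := Fact.out
      have hz := Complex.isPrimitiveRoot_exp N hp.ne_zero
      have hc : ((j : ℕ) + 1).Coprime N := by
        have := j.2
        exact (Nat.Coprime.symm <| (hp.coprime_iff_not_dvd).2 fun h => by
          have := Nat.le_of_dvd (by omega) h
          omega)
      rw [← eval_map, map_cyclotomic]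
      have h := (hz.pow_of_coprime _ hc).isRoot_cyclotomic hp.pos
      exact h)

/-- The algebraic norm is the product of the conjugates. -/
theorem CycO.norm_eq_prod_sigma {N : ℕ} [Fact N.Prime] (β : CycO N) :
    (CycO.norm β : ℂ) = ∏ j : Fin (N - 1), CycO.sigma N j β := by
  have hp : N.Prime := Fact.out
  have hz := Complex.isPrimitiveRoot_exp N hp.ne_zero
  set z : Fin (N - 1) → ℂ :=
    fun j => Complex.exp (2 * Real.pi * Complex.I / N) ^ ((j : ℕ) + 1) with hzdef
  have hσ : ∀ j, CycO.sigma N j (CycO.zeta N) = z j := fun j => AdjoinRoot.lift_root _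
  let V : Matrix (Fin (N - 1)) (Fin (N - 1)) ℂ :=
    Matrix.of fun j k => CycO.sigma N j (CycO.basis N k)
  have hV : V = Matrix.diagonal z * Matrix.vandermonde z := by
    ext j k
    rw [Matrix.diagonal_mul]
    simp [V, CycO.basis_apply, hσ, Matrix.vandermonde_apply, pow_succ']
  have hinj : Function.Injective z := by
    intro a b hab
    have ha := a.2
    have hb := b.2
    have := hz.pow_inj (by omega) (by omega) hab
    exact Fin.ext (by omega)
  have hdet : V.det ≠ 0 := by
    rw [hV, Matrix.det_mul, Matrix.det_diagonal]
    refine mul_ne_zero (Finset.prod_ne_zero_iff.2 fun j _ => ?_)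
      (Matrix.det_vandermonde_ne_zero_iff.2 hinj)
    exact pow_ne_zero _ (Complex.exp_ne_zero _)
  let M := (Algebra.leftMulMatrix (CycO.basis N) β).map (Int.castRingHom ℂ)
  have hmul : V * M = Matrix.diagonal (fun j => CycO.sigma N j β) * V := by
    ext j k
    rw [Matrix.diagonal_mul, Matrix.mul_apply]
    simp only [V, M, Matrix.of_apply, Matrix.map_apply]
    rw [← map_mul (CycO.sigma N j)]
    conv_rhs => rw [← (CycO.basis N).sum_repr (β * CycO.basis N k)]
    rw [map_sum]
    refine Finset.sum_congr rfl fun l _ => ?_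
    rw [Algebra.leftMulMatrix_eq_repr_mul, zsmul_eq_mul, map_mul (CycO.sigma N j), map_intCast,
      mul_comm]
    simp
  have h := congrArg Matrix.det hmul
  rw [Matrix.det_mul, Matrix.det_mul, Matrix.det_diagonal, mul_comm] at h
  have h2 := mul_right_cancel₀ hdet h
  rw [← h2, CycO.norm, Algebra.norm_eq_matrix_det (CycO.basis N)]
  exact RingHom.map_det (Int.castRingHom ℂ) _

end BitRetrieval

/-!
The Fourier components `σ_j : R → ℂ`, `x ↦ exp (2 π i j / N)`, turn conjugation of `R` into complex
conjugation, so `τ τ̄ = b b̄` says that `|σ_j(τ)| = |σ_j(b)|` for all `j` (`mem_torusSet_iff`). With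
`N = 2 m + 1`, the components at the frequencies `0, 1, …, m` identify `R` with `ℝ × ℂᵐ`; the other
components are conjugates of these. In these coordinates the set is the union of the two products
of circles `{±σ₀(b)} × ∏ k, {|z_k| = |σ_k(b)|}`, which are disjoint since `σ₀(b) ≠ 0`. The shift
does not affect `σ_k(b)` for `k ≠ 0`, which is the `k`th conjugate of `β` (`CycR.sigma_embed`), so
that `𝒩(β) = ∏ k, |σ_k(b)|²` (`CycO.norm_eq_prod_sq`); in particular all radii are positive when
`β ≠ 0`.

For the volume, Parseval's identity `N ‖τ‖² = σ₀(τ)² + 2 ∑ k, |σ_k(τ)|²` shows that each torus is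
isometric to a product of round circles of circumferences `2 π √(2 / N) |σ_k(b)|`. Parametrization
by arc length is `1`-Lipschitz, and its local inverses are `K`-Lipschitz at small scales for every
`K > 1`, because `sin t / t → 1`. Cutting the parameter box into small pieces, one sees that such a
map preserves Hausdorff measure
(`hausdorffMeasure_image_of_lipschitz_of_local_antilipschitz`), so the volume is the product of the
circumferences. For `β = 0` each torus degenerates to a point, of volume zero since `m > 0`.
-/

namespace BitRetrieval

/-! ### Hausdorff measure and local isometries -/

section AlmostIsometry

open MeasureTheory Measure Filter Topology
open scoped NNReal ENNReal

/-- A `1`-Lipschitz map that is injective on a measurable set `s` and whose inverse has, at small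
scales, Lipschitz constant arbitrarily close to `1`, preserves the Hausdorff measure of `s`. -/
theorem hausdorffMeasure_image_of_lipschitz_of_local_antilipschitz
    {X Y : Type*} [MetricSpace X] [MeasurableSpace X] [BorelSpace X] [CompleteSpace X]
    [SecondCountableTopology X] [MetricSpace Y] [MeasurableSpace Y] [BorelSpace Y]
    {f : X → Y} {s : Set X} (hs : MeasurableSet s) (hlip : LipschitzWith 1 f)
    (hinj : Set.InjOn f s)
    (hanti : ∀ K : ℝ≥0, 1 < K → ∃ δ > 0, ∀ x y, dist x y < δ → dist x y ≤ K * dist (f x) (f y))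
    {d : ℝ} (hd : 0 ≤ d) : μH[d] (f '' s) = μH[d] s := by
  refine le_antisymm ?_ ?_
  · simpa using (hlip.lipschitzOnWith (s := s)).hausdorffMeasure_image_le hd
  have key : ∀ K : ℝ≥0, 1 < K → μH[d] s ≤ (K : ℝ≥0∞) ^ d * μH[d] (f '' s) := by
    intro K hK
    obtain ⟨δ, hδ, hanti⟩ := hanti K hK
    rcases isEmpty_or_nonempty X with hX | hX
    · simp [Set.eq_empty_of_isEmpty s]
    -- cut `s` into countably many measurable pieces of diameter less than `δ`
    let u := TopologicalSpace.denseSeq X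
    let p : ℕ → Set X := fun n => s ∩ disjointed (fun n => Metric.ball (u n) (δ / 2)) n
    have hpm : ∀ n, MeasurableSet (p n) := fun n =>
      hs.inter (MeasurableSet.disjointed (fun _ => measurableSet_ball) n)
    have hcover : ⋃ n, Metric.ball (u n) (δ / 2) = Set.univ :=
      Set.eq_univ_of_forall fun x => by
        obtain ⟨n, hn⟩ := (TopologicalSpace.denseRange_denseSeq X).exists_dist_lt x (half_pos hδ)
        exact Set.mem_iUnion.2 ⟨n, hn⟩
    have hpu : ⋃ n, p n = s := by
      rw [← Set.inter_iUnion, iUnion_disjointed, hcover, Set.inter_univ]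
    have hpd : Pairwise (Function.onFun Disjoint p) := fun i j hij =>
      ((disjoint_disjointed _ hij).mono Set.inter_subset_right Set.inter_subset_right)
    have hps : ∀ n, p n ⊆ s := fun n => Set.inter_subset_left
    have hpiece : ∀ n, μH[d] (p n) ≤ (K : ℝ≥0∞) ^ d * μH[d] (f '' p n) := by
      intro n
      have hin : Set.InjOn f (p n) := hinj.mono (hps n)
      have hl : LipschitzOnWith K (Function.invFunOn f (p n)) (f '' p n) := by
        refine LipschitzOnWith.of_dist_le_mul ?_
        rintro _ ⟨x, hx, rfl⟩ _ ⟨y, hy, rfl⟩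
        rw [hin.leftInvOn_invFunOn hx, hin.leftInvOn_invFunOn hy]
        refine hanti x y ?_
        have h1 := disjointed_subset _ _ hx.2
        have h2 := disjointed_subset _ _ hy.2
        calc dist x y ≤ dist x (u n) + dist y (u n) := dist_triangle_right _ _ _
          _ < δ / 2 + δ / 2 := add_lt_add h1 h2
          _ = δ := add_halves δ
      have := hl.hausdorffMeasure_image_le hd
      rwa [hin.leftInvOn_invFunOn.image_image] at this
    calc μH[d] s = ∑' n, μH[d] (p n) := by rw [← measure_iUnion hpd hpm, hpu]
      _ ≤ ∑' n, (K : ℝ≥0∞) ^ d * μH[d] (f '' p n) := ENNReal.tsum_le_tsum hpiece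
      _ = (K : ℝ≥0∞) ^ d * ∑' n, μH[d] (f '' p n) := ENNReal.tsum_mul_left
      _ = (K : ℝ≥0∞) ^ d * μH[d] (f '' s) := by
        rw [← measure_iUnion (fun i j hij => ?_) (fun n => ?_), ← Set.image_iUnion, hpu]
        · rw [Function.onFun, Set.disjoint_left]
          rintro _ ⟨x, hx, rfl⟩ ⟨y, hy, hyx⟩
          rw [hinj (hps j hy) (hps i hx) hyx] at hy
          exact Set.disjoint_left.1 (hpd hij) hx hy
        · exact (hpm n).image_of_continuousOn_injOn hlip.continuous.continuousOn
            (hinj.mono (hps n))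
  have hlim : Tendsto (fun K : ℝ≥0 => (K : ℝ≥0∞) ^ d * μH[d] (f '' s)) (𝓝[>] 1)
      (𝓝 (((1 : ℝ≥0) : ℝ≥0∞) ^ d * μH[d] (f '' s))) := by
    refine ENNReal.Tendsto.mul_const ?_ (Or.inl (by simp))
    exact ((ENNReal.continuous_rpow_const.comp ENNReal.continuous_coe).tendsto 1).mono_left
      nhdsWithin_le_nhds
  simpa using ge_of_tendsto hlim (eventually_nhdsWithin_of_forall fun K hK => key K hK)

/-- The previous lemma for the normalization of Hausdorff measure that extends Lebesgue measure. -/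
theorem euclideanHausdorffMeasure_image_of_lipschitz_of_local_antilipschitz
    {X Y : Type*} [MetricSpace X] [MeasurableSpace X] [BorelSpace X] [CompleteSpace X]
    [SecondCountableTopology X] [MetricSpace Y] [MeasurableSpace Y] [BorelSpace Y]
    {f : X → Y} {s : Set X} (hs : MeasurableSet s) (hlip : LipschitzWith 1 f)
    (hinj : Set.InjOn f s)
    (hanti : ∀ K : ℝ≥0, 1 < K → ∃ δ > 0, ∀ x y, dist x y < δ → dist x y ≤ K * dist (f x) (f y))
    (d : ℕ) : μHE[d] (f '' s) = μHE[d] s := by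
  rw [euclideanHausdorffMeasure_def, euclideanHausdorffMeasure_def, Measure.smul_apply,
    Measure.smul_apply,
    hausdorffMeasure_image_of_lipschitz_of_local_antilipschitz hs hlip hinj hanti d.cast_nonneg]

theorem volume_euclidean_box {m : ℕ} (c : Fin m → ℝ) :
    volume {w : EuclideanSpace ℝ (Fin m) | ∀ k, w k ∈ Set.Ico 0 (c k)} =
      ∏ k, ENNReal.ofReal (c k) := by
  have h := (PiLp.volume_preserving_ofLp (Fin m)).measure_preimage
    (MeasurableSet.univ_pi fun k : Fin m =>
      (measurableSet_Ico : MeasurableSet (Set.Ico (0 : ℝ) (c k)))).nullMeasurableSet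
  have hset : {w : EuclideanSpace ℝ (Fin m) | ∀ k, w k ∈ Set.Ico 0 (c k)} =
      WithLp.ofLp ⁻¹' (Set.univ.pi fun k => Set.Ico (0 : ℝ) (c k)) := by
    ext w
    simp only [Set.mem_ofPred_eq, Set.mem_preimage, Set.mem_univ_pi]
  rw [hset, h, volume_pi_pi]
  simp [Real.volume_Ico]

/-- On a circle of circumference `c`, short arcs are at most `K` times as long as their chords. -/
theorem eventually_abs_le_mul_abs_sin {c : ℝ} (hc : 0 < c) {K : ℝ} (hK : 1 < K) :
    ∀ᶠ t in 𝓝 (0 : ℝ), |t| ≤ K * |c / Real.pi * Real.sin (Real.pi * (t / c))| := by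
  have hcont : Continuous fun t : ℝ => K * Real.sinc (Real.pi * (t / c)) := by fun_prop
  have h0 : (1 : ℝ) < K * Real.sinc (Real.pi * (0 / c)) := by simpa using hK
  filter_upwards [hcont.continuousAt.eventually_const_lt h0] with t ht
  rcases eq_or_ne t 0 with rfl | htne
  · simp
  have hx : Real.pi * (t / c) ≠ 0 := by positivity
  have hpi := Real.pi_pos
  have hs : c / Real.pi * Real.sin (Real.pi * (t / c)) = t * Real.sinc (Real.pi * (t / c)) := by
    rw [Real.sinc_of_ne_zero hx]
    field_simp
  rw [hs, abs_mul]
  calc |t| = |t| * 1 := (mul_one _).symm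
    _ ≤ |t| * (K * |Real.sinc (Real.pi * (t / c))|) := by
      refine mul_le_mul_of_nonneg_left (ht.le.trans ?_) (abs_nonneg t)
      exact mul_le_mul_of_nonneg_left (le_abs_self _) (by linarith)
    _ = _ := by ring

/-- On a circle of circumference `c`, a chord is at most as long as its arc. -/
theorem abs_mul_sin_le {c : ℝ} (hc : 0 < c) (t : ℝ) :
    |c / Real.pi * Real.sin (Real.pi * (t / c))| ≤ |t| := by
  have hpi := Real.pi_pos
  calc |c / Real.pi * Real.sin (Real.pi * (t / c))|
      = c / Real.pi * |Real.sin (Real.pi * (t / c))| := by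
        rw [abs_mul, abs_of_pos (by positivity : 0 < c / Real.pi)]
    _ ≤ c / Real.pi * |Real.pi * (t / c)| :=
        mul_le_mul_of_nonneg_left Real.abs_sin_le_abs (by positivity)
    _ = |t| := by
        rw [abs_mul, abs_div, abs_of_pos hpi, abs_of_pos hc]
        field_simp

theorem sin_pi_mul_eq_zero_iff (t : ℝ) : Real.sin (Real.pi * t) = 0 ↔ ∃ k : ℤ, t = k := by
  rw [Real.sin_eq_zero_iff]
  constructor
  · rintro ⟨k, hk⟩
    exact ⟨k, mul_left_cancel₀ Real.pi_ne_zero (by linarith)⟩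
  · rintro ⟨k, rfl⟩
    exact ⟨k, mul_comm _ _⟩

/-- The volume of a product of circles of circumferences `c k`, parametrized proportionally to arc
length by `ℝᵐ / ℤᵐ`. The hypothesis on distances says that the image carries the metric of a
product of round circles, in which `c / π * |sin (π t)|` is the length of a chord. -/
theorem euclideanHausdorffMeasure_range_of_dist_sq {Y : Type*} [MetricSpace Y] [MeasurableSpace Y]
    [BorelSpace Y] {m : ℕ} {c : Fin m → ℝ} (hc : ∀ k, 0 < c k)
    {h : EuclideanSpace ℝ (Fin m) → Y}
    (hh : ∀ u v, dist (h u) (h v) ^ 2 =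
      ∑ k, (c k / Real.pi * Real.sin (Real.pi * (u k - v k))) ^ 2) :
    μHE[m] (Set.range h) = ∏ k, ENNReal.ofReal (c k) := by
  have hpi := Real.pi_pos
  -- `f` is the parametrization by arc length, on the box `s` with side lengths `c k`
  let f : EuclideanSpace ℝ (Fin m) → Y := fun w => h (WithLp.toLp 2 fun k => w k / c k)
  let s : Set (EuclideanSpace ℝ (Fin m)) := {w | ∀ k, w k ∈ Set.Ico 0 (c k)}
  have hf : ∀ w w', dist (f w) (f w') ^ 2 =
      ∑ k, (c k / Real.pi * Real.sin (Real.pi * ((w k - w' k) / c k))) ^ 2 := by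
    intro w w'
    simp only [f, hh, sub_div]
  have heq : ∀ u v, (∀ k, ∃ n : ℤ, u k - v k = (n : ℝ)) ↔ h u = h v := by
    intro u v
    rw [← dist_eq_zero, ← sq_eq_zero_iff, hh, Finset.sum_eq_zero_iff_of_nonneg
      (fun _ _ => sq_nonneg _)]
    refine forall_congr' fun k => ?_
    have : c k / Real.pi ≠ 0 := (div_pos (hc k) hpi).ne'
    simp [this, sin_pi_mul_eq_zero_iff]
  have hs : MeasurableSet s := by
    have : s = ⋂ k, {w | w k ∈ Set.Ico 0 (c k)} := by ext; simp [s]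
    rw [this]
    refine MeasurableSet.iInter fun k => ?_
    exact measurableSet_Ico.preimage
      (by fun_prop : Measurable fun w : EuclideanSpace ℝ (Fin m) => w k)
  have hrange : Set.range h = f '' s := by
    refine Set.Subset.antisymm ?_ (by rintro _ ⟨w, -, rfl⟩; exact ⟨_, rfl⟩)
    rintro _ ⟨u, rfl⟩
    refine ⟨WithLp.toLp 2 fun k => c k * Int.fract (u k), fun k => ?_, ?_⟩
    · exact ⟨mul_nonneg (hc k).le (Int.fract_nonneg _),
        mul_lt_of_lt_one_right (hc k) (Int.fract_lt_one _)⟩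
    · refine (heq _ _).1 fun k => ⟨-⌊u k⌋, ?_⟩
      have : c k ≠ 0 := (hc k).ne'
      simp only [mul_div_cancel_left₀ _ this, Int.fract]
      push_cast
      ring
  have hinj : Set.InjOn f s := by
    intro w hw w' hw' hww
    have h1 := (heq _ _).2 hww
    ext k
    obtain ⟨n, hn⟩ := h1 k
    have hck := hc k
    have hmem : ∀ x ∈ Set.Ico 0 (c k), 0 ≤ x / c k ∧ x / c k < 1 := fun x hx =>
      ⟨div_nonneg hx.1 hck.le, (div_lt_one hck).2 hx.2⟩
    have ha := hmem _ (hw k)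
    have hb := hmem _ (hw' k)
    simp only at hn
    have hlt : (n : ℝ) < 1 := by linarith
    have hgt : (-1 : ℝ) < n := by linarith
    have h0 : n = 0 := by
      have h2 : n < 1 := by exact_mod_cast hlt
      have h3 : -1 < n := by exact_mod_cast hgt
      omega
    rw [h0, Int.cast_zero, sub_eq_zero] at hn
    exact (div_left_inj' hck.ne').1 hn
  have hlip : LipschitzWith 1 f := by
    refine LipschitzWith.of_dist_le_mul fun w w' => ?_
    rw [NNReal.coe_one, one_mul]
    refine le_of_sq_le_sq ?_ dist_nonneg
    rw [hf, EuclideanSpace.dist_sq_eq]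
    refine Finset.sum_le_sum fun k _ => ?_
    rw [Real.dist_eq, ← sq_abs (c k / _ * _)]
    exact pow_le_pow_left₀ (abs_nonneg _) (abs_mul_sin_le (hc k) _) 2
  have hanti : ∀ K : ℝ≥0, 1 < K → ∃ δ > 0, ∀ x y, dist x y < δ →
      dist x y ≤ K * dist (f x) (f y) := by
    intro K hK
    have hev : ∀ᶠ t in 𝓝 (0 : ℝ), ∀ k,
        |t| ≤ K * |c k / Real.pi * Real.sin (Real.pi * (t / c k))| :=
      eventually_all.2 fun k => eventually_abs_le_mul_abs_sin (hc k) (by exact_mod_cast hK)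
    obtain ⟨δ, hδ, hev⟩ := Metric.eventually_nhds_iff.1 hev
    refine ⟨δ, hδ, fun w w' hww => ?_⟩
    refine le_of_sq_le_sq ?_ (by positivity)
    rw [mul_pow, hf, EuclideanSpace.dist_sq_eq, Finset.mul_sum]
    refine Finset.sum_le_sum fun k _ => ?_
    have hk : dist (w k - w' k) 0 < δ := by
      rw [dist_zero_right, ← PiLp.sub_apply]
      refine (PiLp.norm_apply_le (w - w') k).trans_lt ?_
      rwa [← dist_eq_norm]
    rw [Real.dist_eq, ← sq_abs (c k / _ * _), ← mul_pow]
    exact pow_le_pow_left₀ (abs_nonneg _) (hev hk k) 2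
  rw [hrange,
    euclideanHausdorffMeasure_image_of_lipschitz_of_local_antilipschitz hs hlip hinj hanti,
    EuclideanSpace.euclideanHausdorffMeasure_eq_volume, volume_euclidean_box]

end AlmostIsometry

/-! ### The Fourier transform of cyclic sequences -/

open scoped ComplexConjugate

/-- The primitive `N`th root of unity `exp (2 π i / N)`. -/
noncomputable def omega (N : ℕ) : ℂ := Complex.exp (2 * Real.pi * Complex.I / N)

theorem isPrimitiveRoot_omega (N : ℕ) [Fact N.Prime] : IsPrimitiveRoot (omega N) N :=
  Complex.isPrimitiveRoot_exp N (Fact.out : N.Prime).ne_zero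

theorem omega_pow (N : ℕ) [Fact N.Prime] : omega N ^ N = 1 := (isPrimitiveRoot_omega N).pow_eq_one

theorem conj_omega_mul (N : ℕ) [Fact N.Prime] : conj (omega N) * omega N = 1 := by
  rw [mul_comm, Complex.mul_conj', (isPrimitiveRoot_omega N).norm'_eq_one
    (Fact.out : N.Prime).ne_zero]
  simp

theorem conj_omega (N : ℕ) [Fact N.Prime] : conj (omega N) = omega N ^ (N - 1) := by
  have hN : N - 1 + 1 = N := Nat.sub_add_cancel (Fact.out : N.Prime).one_le
  have h0 : omega N ≠ 0 := (isPrimitiveRoot_omega N).ne_zero (Fact.out : N.Prime).ne_zero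
  refine mul_right_cancel₀ h0 ?_
  rw [conj_omega_mul, ← pow_succ, hN, omega_pow]

/-- The Fourier component `σ_j : R → ℂ`, the `ℝ`-algebra homomorphism with
`x ↦ exp (2 π i j / N)`. -/
noncomputable def CycR.sigma (N : ℕ) [Fact N.Prime] (j : ℕ) : CycR N →ₐ[ℝ] ℂ :=
  AdjoinRoot.liftAlgHom (X ^ N - 1 : ℝ[X]) (Algebra.ofId ℝ ℂ) (omega N ^ j) (by
    simp only [eval₂_sub, eval₂_pow, eval₂_X, eval₂_one]
    rw [← pow_mul, mul_comm, pow_mul, omega_pow, one_pow, sub_self])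

theorem CycR.sigma_x (N : ℕ) [Fact N.Prime] (j : ℕ) :
    CycR.sigma N j (CycR.x N) = omega N ^ j := AdjoinRoot.liftAlgHom_root ..

theorem CycR.sigma_apply {N : ℕ} [Fact N.Prime] (j : ℕ) (τ : CycR N) :
    CycR.sigma N j τ = ∑ i : Fin N, (CycR.comp τ i : ℂ) * omega N ^ (j * i) := by
  conv_lhs => rw [← (CycR.basis N).sum_repr τ]
  simp [CycR.basis_apply, CycR.sigma_x, CycR.comp, pow_mul, -Module.Basis.sum_repr]

theorem CycR.sigma_zero_apply {N : ℕ} [Fact N.Prime] (τ : CycR N) :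
    CycR.sigma N 0 τ = CycR.sigmaZero τ := by
  simp [CycR.sigma_apply, CycR.sigmaZero]

theorem CycR.sigma_bar {N : ℕ} [Fact N.Prime] (j : ℕ) (τ : CycR N) :
    CycR.sigma N j (CycR.bar N τ) = conj (CycR.sigma N j τ) := by
  have h : (CycR.sigma N j).comp (CycR.bar N) =
      (Complex.conjAe : ℂ →ₐ[ℝ] ℂ).comp (CycR.sigma N j) := by
    refine AdjoinRoot.algHom_ext ?_
    simp only [AlgHom.comp_apply]
    rw [CycR.bar, AdjoinRoot.liftAlgHom_root, map_pow, CycR.sigma_x]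
    simp [conj_omega, ← pow_mul, mul_comm]
  exact congrArg (fun f => f τ) h

theorem CycR.sigma_conj {N : ℕ} [Fact N.Prime] {j k : ℕ} (hjk : j + k = N) (τ : CycR N) :
    CycR.sigma N k τ = conj (CycR.sigma N j τ) := by
  have h : CycR.sigma N k = (Complex.conjAe : ℂ →ₐ[ℝ] ℂ).comp (CycR.sigma N j) := by
    refine AdjoinRoot.algHom_ext ?_
    simp only [AlgHom.comp_apply]
    rw [CycR.sigma_x, CycR.sigma_x]
    have h0 : omega N ^ j ≠ 0 :=
      pow_ne_zero _ ((isPrimitiveRoot_omega N).ne_zero (Fact.out : N.Prime).ne_zero)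
    refine mul_right_cancel₀ h0 ?_
    simp only [AlgEquiv.coe_toAlgHom, Complex.conjAe_coe, map_pow]
    rw [← mul_pow, conj_omega_mul, one_pow, ← pow_add, add_comm, hjk, omega_pow]
  exact congrArg (fun f => f τ) h

/-- Orthogonality of the characters of the cyclic group. -/
theorem sum_omega_pow_mul_conj {N : ℕ} [Fact N.Prime] (i l : Fin N) :
    ∑ j ∈ Finset.range N, omega N ^ (j * i) * conj (omega N ^ (j * l)) =
      if i = l then (N : ℂ) else 0 := by
  have hterm : ∀ j : ℕ, omega N ^ (j * i) * conj (omega N ^ (j * l)) =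
      (omega N ^ (i : ℕ) * conj (omega N) ^ (l : ℕ)) ^ j := by
    intro j
    rw [map_pow, mul_pow, ← pow_mul, ← pow_mul, mul_comm j, mul_comm j]
  simp_rw [hterm]
  have hpow : ∀ n : ℕ, omega N ^ n * conj (omega N) ^ n = 1 := fun n => by
    rw [← mul_pow, mul_comm, conj_omega_mul, one_pow]
  split_ifs with h
  · simp [h, hpow]
  · have hne : omega N ^ (i : ℕ) * conj (omega N) ^ (l : ℕ) ≠ 1 := by
      intro h1
      refine h (Fin.ext ((isPrimitiveRoot_omega N).pow_inj i.2 l.2 ?_))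
      calc omega N ^ (i : ℕ)
          = omega N ^ (i : ℕ) * conj (omega N) ^ (l : ℕ) * omega N ^ (l : ℕ) := by
            rw [mul_assoc, mul_comm (conj (omega N) ^ (l : ℕ)), hpow, mul_one]
        _ = omega N ^ (l : ℕ) := by rw [h1, one_mul]
    have hN : (omega N ^ (i : ℕ) * conj (omega N) ^ (l : ℕ)) ^ N = 1 := by
      rw [mul_pow, ← pow_mul, ← pow_mul, mul_comm (i : ℕ), mul_comm (l : ℕ), pow_mul, pow_mul,
        omega_pow, ← map_pow, omega_pow]
      simp
    rw [geom_sum_eq hne, hN, sub_self, zero_div]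

/-- Parseval's identity. -/
theorem CycR.sum_norm_sigma_sq {N : ℕ} [Fact N.Prime] (τ : CycR N) :
    ∑ j ∈ Finset.range N, ‖CycR.sigma N j τ‖ ^ 2 = N * ∑ i, CycR.comp τ i ^ 2 := by
  have h : ∀ j, ((‖CycR.sigma N j τ‖ ^ 2 : ℝ) : ℂ) = ∑ i : Fin N, ∑ l : Fin N,
      (CycR.comp τ i : ℂ) * CycR.comp τ l * (omega N ^ (j * i) * conj (omega N ^ (j * l))) := by
    intro j
    rw [Complex.ofReal_pow, ← Complex.mul_conj', CycR.sigma_apply, map_sum,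
      Finset.sum_mul_sum]
    refine Finset.sum_congr rfl fun i _ => Finset.sum_congr rfl fun l _ => ?_
    rw [map_mul, Complex.conj_ofReal]
    ring
  rw [← Complex.ofReal_inj, Complex.ofReal_sum]
  simp_rw [h]
  rw [Finset.sum_comm]
  simp_rw [Finset.sum_comm (s := Finset.range N), ← Finset.mul_sum, sum_omega_pow_mul_conj]
  simp [Finset.mul_sum]
  refine Finset.sum_congr rfl fun i _ => ?_
  ring

/-- Pairing the index `j` with `2 m + 1 - j` in a product over `1 ≤ j ≤ 2 m`. -/
@[to_additive sum_range_two_mul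
  /-- Pairing the index `j` with `2 m + 1 - j` in a sum over `1 ≤ j ≤ 2 m`. -/]
theorem prod_range_two_mul {M : Type*} [CommMonoid M] (f : ℕ → M) (m : ℕ) :
    ∏ j ∈ Finset.range (2 * m), f (j + 1) =
      ∏ k : Fin m, f (k + 1) * f (2 * m + 1 - (k + 1)) := by
  rw [two_mul, Finset.prod_range_add, Finset.prod_mul_distrib, ← Fin.prod_univ_eq_prod_range,
    ← Fin.prod_univ_eq_prod_range, ← Equiv.prod_comp Fin.revPerm fun k : Fin m => f (m + k + 1)]
  congr 1
  refine Finset.prod_congr rfl fun k _ => ?_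
  have := k.2
  rw [Fin.revPerm_apply, Fin.val_rev]
  congr 1
  omega

theorem CycR.sigma_sub {N : ℕ} [Fact N.Prime] {j : ℕ} (hj : j ≤ N) (τ : CycR N) :
    CycR.sigma N (N - j) τ = conj (CycR.sigma N j τ) :=
  CycR.sigma_conj (by omega) τ

/-- Parseval's identity with the terms for the conjugate frequencies `j` and `N - j` joined. -/
theorem CycR.mul_norm_toEuclidean_sq {N m : ℕ} [Fact N.Prime] (hm : N = 2 * m + 1) (τ : CycR N) :
    N * ‖CycR.toEuclidean N τ‖ ^ 2 =
      CycR.sigmaZero τ ^ 2 + 2 * ∑ k : Fin m, ‖CycR.sigma N (k + 1) τ‖ ^ 2 := by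
  have hsplit : ∑ j ∈ Finset.range N, ‖CycR.sigma N j τ‖ ^ 2 =
      ∑ j ∈ Finset.range (2 * m), ‖CycR.sigma N (j + 1) τ‖ ^ 2 + ‖CycR.sigma N 0 τ‖ ^ 2 := by
    rw [← Finset.sum_range_succ' (fun j => ‖CycR.sigma N j τ‖ ^ 2), ← hm]
  rw [EuclideanSpace.real_norm_sq_eq]
  simp_rw [CycR.toEuclidean_apply]
  rw [← CycR.sum_norm_sigma_sq, hsplit, CycR.sigma_zero_apply, Complex.norm_real, Real.norm_eq_abs,
    sq_abs, sum_range_two_mul (fun j => ‖CycR.sigma N j τ‖ ^ 2), add_comm, Finset.mul_sum]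
  congr 1
  refine Finset.sum_congr rfl fun k _ => ?_
  rw [← hm, CycR.sigma_sub (by omega), RCLike.norm_conj, two_mul]

/-- The product over all non-zero frequencies is the product of squared moduli over half of
them. -/
theorem CycR.prod_sigma {N m : ℕ} [Fact N.Prime] (hm : N = 2 * m + 1) (τ : CycR N) :
    ∏ j : Fin (N - 1), CycR.sigma N (j + 1) τ =
      ((∏ k : Fin m, ‖CycR.sigma N (k + 1) τ‖) ^ 2 : ℝ) := by
  rw [Fin.prod_univ_eq_prod_range (fun j => CycR.sigma N (j + 1) τ),
    show N - 1 = 2 * m by omega, prod_range_two_mul (fun j => CycR.sigma N j τ),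
    ← Finset.prod_pow, Complex.ofReal_prod]
  refine Finset.prod_congr rfl fun k _ => ?_
  rw [← hm, CycR.sigma_sub (by omega), Complex.mul_conj', Complex.ofReal_pow]

/-- The Fourier transform `τ ↦ (σ₀(τ), σ₁(τ), …, σ_m(τ))` of cyclic sequences of odd length
`N = 2 m + 1`, as a real linear equivalence; the remaining components are the conjugates of
these. -/
noncomputable def fourier {N m : ℕ} [Fact N.Prime] (hm : N = 2 * m + 1) :
    CycR N ≃ₗ[ℝ] ℝ × (Fin m → ℂ) :=
  LinearEquiv.ofInjectiveOfFinrankEq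
    ((Complex.reLm ∘ₗ (CycR.sigma N 0).toLinearMap).prod
      (LinearMap.pi fun k : Fin m => (CycR.sigma N (k + 1)).toLinearMap))
    (by
      refine (injective_iff_map_eq_zero _).2 fun τ hτ => ?_
      have h := CycR.mul_norm_toEuclidean_sq hm τ
      have h0 : CycR.sigmaZero τ = 0 := by
        simpa [CycR.sigma_zero_apply] using congrArg Prod.fst hτ
      have hk : ∀ k : Fin m, CycR.sigma N (k + 1) τ = 0 := fun k => by
        simpa using congrFun (congrArg Prod.snd hτ) k
      have hN : (N : ℝ) ≠ 0 := by exact_mod_cast (Fact.out : N.Prime).ne_zero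
      simpa [h0, hk, hN] using h)
    (by
      rw [Module.finrank_eq_card_basis (CycR.basis N)]
      simp [Module.finrank_pi_fintype]
      omega)

theorem fourier_apply {N m : ℕ} [Fact N.Prime] (hm : N = 2 * m + 1) (τ : CycR N) :
    fourier hm τ = (CycR.sigmaZero τ, fun k : Fin m => CycR.sigma N (k + 1) τ) := by
  rw [fourier, ← LinearEquiv.coe_toLinearMap, LinearEquiv.coe_ofInjectiveOfFinrankEq]
  ext
  · simp [CycR.sigma_zero_apply]
  · simp

/-- A sequence `τ` solves `τ τ̄ = b b̄` precisely when all Fourier components of `τ` and `b` have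
the same modulus. -/
theorem mem_torusSet_iff {N m : ℕ} [Fact N.Prime] (hm : N = 2 * m + 1) (b τ : CycR N) :
    τ ∈ torusSet (b * CycR.bar N b) ↔
      (CycR.sigmaZero τ = CycR.sigmaZero b ∨ CycR.sigmaZero τ = -CycR.sigmaZero b) ∧
        ∀ k : Fin m, ‖CycR.sigma N (k + 1) τ‖ = ‖CycR.sigma N (k + 1) b‖ := by
  have hs : ∀ (j : ℕ) (t : CycR N),
      CycR.sigma N j (t * CycR.bar N t) = ((‖CycR.sigma N j t‖ ^ 2 : ℝ) : ℂ) := fun j t => by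
    rw [map_mul, CycR.sigma_bar, Complex.mul_conj', Complex.ofReal_pow]
  have h0 : ∀ t : CycR N, CycR.sigmaZero (t * CycR.bar N t) = CycR.sigmaZero t ^ 2 := fun t => by
    have := hs 0 t
    rw [CycR.sigma_zero_apply, CycR.sigma_zero_apply, Complex.norm_real, Real.norm_eq_abs,
      sq_abs] at this
    exact Complex.ofReal_injective this
  rw [torusSet, Set.mem_ofPred_eq, ← (fourier hm).injective.eq_iff, fourier_apply, fourier_apply,
    Prod.mk.injEq, h0, h0, sq_eq_sq_iff_eq_or_eq_neg, funext_iff]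
  simp only [hs, Complex.ofReal_inj, sq_eq_sq₀ (norm_nonneg _) (norm_nonneg _)]

/-! ### Cyclotomic integers -/

theorem CycO.isDomain (N : ℕ) [Fact N.Prime] : IsDomain (CycO N) :=
  AdjoinRoot.isDomain_of_prime (cyclotomic.irreducible (Fact.out : N.Prime).pos).prime

theorem CycO.norm_ne_zero {N : ℕ} [Fact N.Prime] {β : CycO N} (hβ : β ≠ 0) : CycO.norm β ≠ 0 := by
  have := CycO.isDomain N
  have := Module.Free.of_basis (CycO.basis N)
  have := Module.Finite.of_basis (CycO.basis N)
  exact Algebra.norm_ne_zero_iff.2 hβ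

/-- At non-zero frequencies the shift is invisible, and the Fourier components of the embedding are
the conjugates of `β`. -/
theorem CycR.sigma_embed {N : ℕ} [Fact N.Prime] (r : ℝ) (β : CycO N) (j : Fin (N - 1)) :
    CycR.sigma N (j + 1) (embed r β) = CycO.sigma N j β := by
  have hp : N.Prime := Fact.out
  have hN : N - 1 + 1 = N := Nat.sub_add_cancel hp.one_le
  have hz : (omega N ^ ((j : ℕ) + 1)) ≠ 1 := by
    intro h
    have := Nat.le_of_dvd (by omega) (((isPrimitiveRoot_omega N).pow_eq_one_iff_dvd _).1 h)
    omega
  have hgeom : ∑ i ∈ Finset.range N, (omega N ^ ((j : ℕ) + 1)) ^ i = 0 := by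
    rw [geom_sum_eq hz, ← pow_mul, mul_comm, pow_mul, omega_pow, one_pow, sub_self, zero_div]
  have hsucc := Finset.sum_range_succ' (fun i => (omega N ^ ((j : ℕ) + 1)) ^ i) (N - 1)
  rw [hN, hgeom, pow_zero] at hsucc
  have hσ : CycO.sigma N j (CycO.zeta N) = omega N ^ ((j : ℕ) + 1) := AdjoinRoot.lift_root _
  have hβ : CycO.sigma N j β =
      ∑ i : Fin (N - 1), (CycO.comp β i : ℂ) * (omega N ^ ((j : ℕ) + 1)) ^ ((i : ℕ) + 1) := by
    conv_lhs => rw [← (CycO.basis N).sum_repr β]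
    simp [CycO.basis_apply, hσ, CycO.comp, -Module.Basis.sum_repr]
  rw [hβ, embed]
  simp only [map_add, map_smul, map_one, map_sum, map_pow, CycR.sigma_x, add_smul,
    Finset.sum_add_distrib, Complex.real_smul, mul_one, Complex.ofReal_intCast]
  rw [← Finset.mul_sum, Fin.sum_univ_eq_sum_range
    (fun i => (omega N ^ ((j : ℕ) + 1)) ^ (i + 1)) (N - 1)]
  linear_combination -(r : ℂ) * hsucc

/-- The conjugates of `β` come in complex conjugate pairs, so `𝒩(β)` is a product of squared moduli
of Fourier components; in particular it is non-negative. -/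
theorem CycO.norm_eq_prod_sq {N m : ℕ} [Fact N.Prime] (hm : N = 2 * m + 1) (r : ℝ) (β : CycO N) :
    (CycO.norm β : ℝ) = (∏ k : Fin m, ‖CycR.sigma N (k + 1) (embed r β)‖) ^ 2 := by
  rw [← Complex.ofReal_inj, ← CycR.prod_sigma hm, Complex.ofReal_intCast,
    CycO.norm_eq_prod_sigma]
  exact Finset.prod_congr rfl fun j _ => (CycR.sigma_embed r β j).symm

/-! ### The two tori -/

/-- The Fourier transform on Euclidean `N`-space. -/
noncomputable def fourierEuclidean {N m : ℕ} [Fact N.Prime] (hm : N = 2 * m + 1) :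
    EuclideanSpace ℝ (Fin N) ≃L[ℝ] ℝ × (Fin m → ℂ) :=
  ((CycR.toEuclidean N).symm.trans (fourier hm)).toContinuousLinearEquiv

section Torus

variable {N m : ℕ} [Fact N.Prime] (hm : N = 2 * m + 1)

theorem fourierEuclidean_toEuclidean (τ : CycR N) :
    fourierEuclidean hm (CycR.toEuclidean N τ) =
      (CycR.sigmaZero τ, fun k : Fin m => CycR.sigma N (k + 1) τ) := by
  simp [fourierEuclidean, fourier_apply]

theorem mul_norm_sq_eq (e : EuclideanSpace ℝ (Fin N)) :
    N * ‖e‖ ^ 2 = (fourierEuclidean hm e).1 ^ 2 +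
      2 * ∑ k, ‖(fourierEuclidean hm e).2 k‖ ^ 2 := by
  obtain ⟨τ, rfl⟩ := (CycR.toEuclidean N).surjective e
  rw [fourierEuclidean_toEuclidean]
  exact CycR.mul_norm_toEuclidean_sq hm τ

/-- The set of sequences whose Fourier component at frequency `0` is `s` and whose components at
the frequencies `1, …, m` have the prescribed moduli `ρ`. -/
def modulusTorus (s : ℝ) (ρ : Fin m → ℝ) : Set (EuclideanSpace ℝ (Fin N)) :=
  {e | (fourierEuclidean hm e).1 = s ∧ ∀ k, ‖(fourierEuclidean hm e).2 k‖ = ρ k}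

/-- The parametrization of `modulusTorus` by the arguments of the Fourier components, in units of
full turns. -/
noncomputable def torusParam (s : ℝ) (ρ : Fin m → ℝ) (u : EuclideanSpace ℝ (Fin m)) :
    EuclideanSpace ℝ (Fin N) :=
  (fourierEuclidean hm).symm
    (s, fun k => (ρ k : ℂ) * Complex.exp (Complex.I * ((2 * Real.pi * u k : ℝ) : ℂ)))

theorem image_torusSet_eq_union (b : CycR N) :
    CycR.toEuclidean N '' torusSet (b * CycR.bar N b) =
      modulusTorus hm (CycR.sigmaZero b) (fun k => ‖CycR.sigma N (k + 1) b‖) ∪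
      modulusTorus hm (-CycR.sigmaZero b) (fun k => ‖CycR.sigma N (k + 1) b‖) := by
  ext e
  obtain ⟨τ, rfl⟩ := (CycR.toEuclidean N).surjective e
  rw [(CycR.toEuclidean N).injective.mem_set_image, mem_torusSet_iff hm]
  simp only [modulusTorus, Set.mem_union, Set.mem_ofPred_eq, fourierEuclidean_toEuclidean,
    or_and_right]

theorem disjoint_modulusTorus {s t : ℝ} (h : s ≠ t) (ρ : Fin m → ℝ) :
    Disjoint (modulusTorus hm s ρ) (modulusTorus hm t ρ) :=
  Set.disjoint_left.2 fun _ h1 h2 => h (h1.1.symm.trans h2.1)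

theorem isClosed_modulusTorus (s : ℝ) (ρ : Fin m → ℝ) : IsClosed (modulusTorus hm s ρ) := by
  have hc := (fourierEuclidean hm).continuous
  simp only [modulusTorus, Set.ofPred_and, Set.ofPred_forall]
  refine (isClosed_eq (by fun_prop) (by fun_prop)).inter (isClosed_iInter fun k => ?_)
  exact isClosed_eq (by fun_prop) (by fun_prop)

theorem range_torusParam (s : ℝ) {ρ : Fin m → ℝ} (hρ : ∀ k, 0 ≤ ρ k) :
    Set.range (torusParam hm s ρ) = modulusTorus hm s ρ := by
  refine Set.Subset.antisymm ?_ ?_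
  · rintro _ ⟨u, rfl⟩
    simp only [modulusTorus, torusParam, Set.mem_ofPred_eq, ContinuousLinearEquiv.apply_symm_apply,
      true_and, norm_mul, Complex.norm_exp_I_mul_ofReal, Complex.norm_real, mul_one]
    exact fun k => Real.norm_of_nonneg (hρ k)
  · rintro e ⟨h1, h2⟩
    refine ⟨WithLp.toLp 2 fun k => ((fourierEuclidean hm e).2 k).arg / (2 * Real.pi), ?_⟩
    rw [torusParam, ContinuousLinearEquiv.symm_apply_eq]
    refine Prod.ext h1.symm (funext fun k => ?_)
    have hpi : 2 * Real.pi ≠ 0 := by positivity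
    simp only [mul_div_cancel₀ _ hpi]
    rw [mul_comm Complex.I, ← h2 k, Complex.norm_mul_exp_arg_mul_I]

theorem contDiff_torusParam (s : ℝ) (ρ : Fin m → ℝ) : ContDiff ℝ ∞ (torusParam hm s ρ) := by
  refine (fourierEuclidean hm).symm.contDiff.comp
    (contDiff_const.prodMk (contDiff_pi.2 fun k => ?_))
  refine contDiff_const.mul (Complex.contDiff_exp.comp (contDiff_const.mul ?_))
  refine Complex.ofRealCLM.contDiff.comp (contDiff_const.mul ?_)
  exact (EuclideanSpace.proj (𝕜 := ℝ) k).contDiff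

/-- The arguments of the Fourier components change at a non-zero rate along every non-zero
direction. -/
theorem injective_fderiv_torusParam (s : ℝ) {ρ : Fin m → ℝ} (hρ : ∀ k, 0 < ρ k)
    (u : EuclideanSpace ℝ (Fin m)) :
    Function.Injective (fderiv ℝ (torusParam hm s ρ) u) := by
  refine (injective_iff_map_eq_zero _).2 fun h hh => ?_
  ext k
  have hd := ((contDiff_torusParam hm s ρ).differentiable (by simp) u).hasFDerivAt
  let proj : EuclideanSpace ℝ (Fin N) →L[ℝ] ℂ :=
    ((ContinuousLinearMap.proj k).comp (ContinuousLinearMap.snd ℝ ℝ (Fin m → ℂ))).comp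
      (fourierEuclidean hm : EuclideanSpace ℝ (Fin N) →L[ℝ] ℝ × (Fin m → ℂ))
  have hcomp : ∀ v, proj (torusParam hm s ρ v) =
      (ρ k : ℂ) * Complex.exp (Complex.I * ((2 * Real.pi * v k : ℝ) : ℂ)) := fun v => by
    simp [proj, torusParam]
  have h1 := proj.hasFDerivAt.comp u hd
  have hv : HasFDerivAt (fun v : EuclideanSpace ℝ (Fin m) => 2 * Real.pi * v k)
      ((2 * Real.pi) • (EuclideanSpace.proj (𝕜 := ℝ) k : EuclideanSpace ℝ (Fin m) →L[ℝ] ℝ)) u :=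
    (EuclideanSpace.proj (𝕜 := ℝ) k).hasFDerivAt.const_mul _
  have h2 := (((Complex.ofRealCLM.hasFDerivAt.comp u hv).const_mul Complex.I).cexp).const_mul
    (ρ k : ℂ)
  have h3 := congrArg (fun L => L h) (h1.unique (h2.congr_of_eventuallyEq
    (Filter.Eventually.of_forall hcomp)))
  have hk := (hρ k).ne'
  simpa [hh, hk, Real.pi_ne_zero] using h3.symm

theorem norm_exp_sub_exp_sq (a b : ℝ) :
    ‖Complex.exp (Complex.I * ((2 * Real.pi * a : ℝ) : ℂ)) -
      Complex.exp (Complex.I * ((2 * Real.pi * b : ℝ) : ℂ))‖ ^ 2 =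
      4 * Real.sin (Real.pi * (a - b)) ^ 2 := by
  have h : Complex.exp (Complex.I * ((2 * Real.pi * a : ℝ) : ℂ)) -
      Complex.exp (Complex.I * ((2 * Real.pi * b : ℝ) : ℂ)) =
      Complex.exp (Complex.I * ((2 * Real.pi * b : ℝ) : ℂ)) *
        (Complex.exp (Complex.I * ((2 * Real.pi * (a - b) : ℝ) : ℂ)) - 1) := by
    rw [mul_sub, ← Complex.exp_add, mul_one]
    congr 2
    push_cast
    ring
  rw [h, norm_mul, Complex.norm_exp_I_mul_ofReal, one_mul, Complex.norm_exp_I_mul_ofReal_sub_one,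
    Real.norm_eq_abs, sq_abs, mul_pow]
  congr 3
  · norm_num
  · ring

/-- By Parseval's identity the `k`th circle factor has radius `√(2 / N) ρ_k`. -/
theorem dist_torusParam_sq (s : ℝ) (ρ : Fin m → ℝ) (u v : EuclideanSpace ℝ (Fin m)) :
    dist (torusParam hm s ρ u) (torusParam hm s ρ v) ^ 2 =
      ∑ k, (√(8 * Real.pi ^ 2 / N) * ρ k / Real.pi * Real.sin (Real.pi * (u k - v k))) ^ 2 := by
  have hN : (0 : ℝ) < N := by exact_mod_cast (Fact.out : N.Prime).pos
  have hpi := Real.pi_pos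
  refine mul_left_cancel₀ hN.ne' ?_
  rw [dist_eq_norm, mul_norm_sq_eq hm, map_sub, torusParam, torusParam,
    ContinuousLinearEquiv.apply_symm_apply, ContinuousLinearEquiv.apply_symm_apply]
  simp only [Prod.fst_sub, Prod.snd_sub, sub_self, Pi.sub_apply, ← mul_sub, norm_mul, mul_pow,
    norm_exp_sub_exp_sq, div_pow, Real.sq_sqrt (by positivity : 0 ≤ 8 * Real.pi ^ 2 / (N : ℝ)),
    Complex.norm_real, Real.norm_eq_abs, sq_abs, Finset.mul_sum]
  rw [zero_pow two_ne_zero, zero_add]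
  refine Finset.sum_congr rfl fun k _ => ?_
  field_simp
  ring

theorem torusParam_eq_iff (s : ℝ) {ρ : Fin m → ℝ} (hρ : ∀ k, 0 < ρ k)
    (u v : EuclideanSpace ℝ (Fin m)) :
    torusParam hm s ρ u = torusParam hm s ρ v ↔ ∀ k, ∃ n : ℤ, u k - v k = n := by
  have hN : (0 : ℝ) < N := by exact_mod_cast (Fact.out : N.Prime).pos
  have hpi := Real.pi_pos
  rw [← dist_eq_zero, ← sq_eq_zero_iff, dist_torusParam_sq, Finset.sum_eq_zero_iff_of_nonneg
    (fun _ _ => sq_nonneg _)]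
  refine ⟨fun h k => ?_, fun h k _ => ?_⟩
  · have hck : √(8 * Real.pi ^ 2 / N) * ρ k / Real.pi ≠ 0 := by
      have := hρ k
      positivity
    have h1 := pow_eq_zero_iff (two_ne_zero) |>.1 (h k (Finset.mem_univ k))
    exact (sin_pi_mul_eq_zero_iff _).1 ((mul_eq_zero.1 h1).resolve_left hck)
  · rw [(sin_pi_mul_eq_zero_iff _).2 (h k), mul_zero, zero_pow two_ne_zero]

theorem isSmoothTorus_modulusTorus (s : ℝ) {ρ : Fin m → ℝ} (hρ : ∀ k, 0 < ρ k) :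
    IsSmoothTorus m (modulusTorus hm s ρ) :=
  ⟨torusParam hm s ρ, contDiff_torusParam hm s ρ, injective_fderiv_torusParam hm s hρ,
    torusParam_eq_iff hm s hρ, range_torusParam hm s fun k => (hρ k).le⟩

theorem volume_modulusTorus (s : ℝ) {ρ : Fin m → ℝ} (hρ : ∀ k, 0 < ρ k) :
    μHE[m] (modulusTorus hm s ρ) = ENNReal.ofReal (√(8 * Real.pi ^ 2 / N) ^ m * ∏ k, ρ k) := by
  have hN : (0 : ℝ) < N := by exact_mod_cast (Fact.out : N.Prime).pos
  have hpi := Real.pi_pos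
  have hc : ∀ k, 0 < √(8 * Real.pi ^ 2 / N) * ρ k := fun k => by
    have := hρ k
    positivity
  rw [← range_torusParam hm s fun k => (hρ k).le,
    euclideanHausdorffMeasure_range_of_dist_sq hc (dist_torusParam_sq hm s ρ),
    ← ENNReal.ofReal_prod_of_nonneg fun k _ => (hc k).le, Finset.prod_mul_distrib,
    Finset.prod_const, Finset.card_univ, Fintype.card_fin]

/-- When all moduli vanish, the torus degenerates to a point. -/
theorem volume_modulusTorus_zero (hm0 : m ≠ 0) (s : ℝ) :
    μHE[m] (modulusTorus hm s fun _ => 0) = 0 := by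
  have hsub : (modulusTorus hm s fun _ => 0).Subsingleton := by
    rintro e ⟨h1, h2⟩ e' ⟨h1', h2'⟩
    refine (fourierEuclidean hm).injective (Prod.ext (h1.trans h1'.symm) (funext fun k => ?_))
    rw [norm_eq_zero.1 (h2 k), norm_eq_zero.1 (h2' k)]
  have := MeasureTheory.Measure.nullSingletonClass_hausdorff (EuclideanSpace ℝ (Fin N))
    (d := (m : ℝ)) (by exact_mod_cast Nat.pos_of_ne_zero hm0)
  rw [MeasureTheory.Measure.euclideanHausdorffMeasure_def, MeasureTheory.Measure.smul_apply,
    hsub.measure_zero, smul_zero]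

end Torus

end BitRetrieval

theorem mainTheorem5 (N : ℕ) [Fact N.Prime] (hN : Odd N)
    (β : BitRetrieval.CycO N) (r : ℝ)
    (hr : (BitRetrieval.embed r β).sigmaZero ≠ 0)
    (α : BitRetrieval.CycR N)
    (hα : α = BitRetrieval.embed r β * BitRetrieval.CycR.bar N (BitRetrieval.embed r β)) :
    (β ≠ 0 → BitRetrieval.IsPairOfSmoothTori ((N - 1) / 2)
      (BitRetrieval.CycR.toEuclidean N '' BitRetrieval.torusSet α)) ∧
    BitRetrieval.CycR.vol ((N - 1) / 2) (BitRetrieval.torusSet α) =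
      ENNReal.ofReal (2 * (8 * Real.pi ^ 2 / N) ^ (((N : ℝ) - 1) / 4) *
        √(BitRetrieval.CycO.norm β : ℝ)) := by
  open BitRetrieval in
  obtain ⟨m, hm⟩ := hN
  have hdim : (N - 1) / 2 = m := by omega
  have hm0 : m ≠ 0 := by
    rintro rfl
    exact (Fact.out : N.Prime).ne_one hm
  set b := embed r β
  set ρ : Fin m → ℝ := fun k => ‖CycR.sigma N (k + 1) b‖
  have hnorm : (CycO.norm β : ℝ) = (∏ k, ρ k) ^ 2 := CycO.norm_eq_prod_sq hm r β
  have hne : CycR.sigmaZero b ≠ -CycR.sigmaZero b := fun h => hr (by linarith)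
  have hpos : β ≠ 0 → ∀ k, 0 < ρ k := by
    intro hβ k
    have h0 : (CycO.norm β : ℝ) ≠ 0 := by exact_mod_cast CycO.norm_ne_zero hβ
    rw [hnorm] at h0
    have h1 := Finset.prod_ne_zero_iff.1 (pow_ne_zero_iff two_ne_zero |>.1 h0) k
      (Finset.mem_univ k)
    exact (norm_nonneg _).lt_of_ne' h1
  rw [CycR.vol, hα, image_torusSet_eq_union hm b, hdim]
  refine ⟨fun hβ => ⟨_, _, isSmoothTorus_modulusTorus hm _ (hpos hβ),
    isSmoothTorus_modulusTorus hm _ (hpos hβ), disjoint_modulusTorus hm hne ρ, rfl⟩, ?_⟩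
  rw [MeasureTheory.measure_union (disjoint_modulusTorus hm hne ρ)
    (isClosed_modulusTorus hm _ ρ).measurableSet]
  rcases eq_or_ne β 0 with hβ | hβ
  · have hρ0 : ρ = fun _ => 0 := by
      funext k
      have := CycR.sigma_embed r β (⟨k, by omega⟩ : Fin (N - 1))
      rw [hβ, map_zero, ← hβ] at this
      exact norm_eq_zero.2 this
    rw [hnorm, hρ0, volume_modulusTorus_zero hm hm0, volume_modulusTorus_zero hm hm0]
    simp [hm0]
  · have hprod : 0 ≤ ∏ k, ρ k := Finset.prod_nonneg fun k _ => norm_nonneg _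
    have hexp : ((N : ℝ) - 1) / 4 = 1 / 2 * (m : ℝ) := by
      rw [hm]
      push_cast
      ring
    have hpow : (8 * Real.pi ^ 2 / N) ^ (((N : ℝ) - 1) / 4) = √(8 * Real.pi ^ 2 / N) ^ m := by
      rw [hexp, Real.rpow_mul (by positivity), ← Real.sqrt_eq_rpow, Real.rpow_natCast]
    rw [volume_modulusTorus hm _ (hpos hβ), volume_modulusTorus hm _ (hpos hβ), hpow, hnorm,
      Real.sqrt_sq hprod, ← ENNReal.ofReal_add (by positivity) (by positivity)]
    congr 1
    ring
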